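/- Let $K<T$ and $M$ be nonnegative integers, let $\rho,\sigma>0$, and let $\mathbf H=[\mathbf h_1\,\cdots\,\mathbf h_K]\in\mathbb C^{M\times K}$ be a channel realization with $\mathbf H^H\mathbf H$ invertible (so $M\ge K$). A zero-forcing (ZF) precoding matrix for $\mathbf H$ is a matrix $\mathbf V=[\mathbf v_1\,\cdots\,\mathbf v_K]=\mathbf H(\mathbf H^H\mathbf H)^{-1}\mathbf D$ with $\mathbf D\in\mathbb C^{K\times K}$ diagonal. The information rate of user $k$ is $$\Big(1-\frac KT\Big)\log_2\Big(1+\frac{|\mathbf h_k^H\mathbf v_k|^2}{\sum_{\ell\ne k}|\mathbf h_k^H\mathbf v_\ell|^2+\sigma^2}\Big).$$ (a) If $\mathbf V$ is a ZF precoding matrix that gives every user the rate $R=\big(1-\frac KT\big)\log_2\big(1+\rho(M-K)\big)$, then the total transmit power is $$\sum_{k=1}^K\|\mathbf v_k\|^2=\rho\sigma^2(M-K)\,\mathrm{tr}\big((\mathbf H^H\mathbf H)^{-1}\big).$$ The choice $\mathbf V=\sqrt{\rho\sigma^2(M-K)}\,\mathbf H(\mathbf H^H\mathbf H)^{-1}$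 is such a matrix, with $\mathbf h_k^H\mathbf v_k=\sqrt{\rho\sigma^2(M-K)}$ for all $k$. (b) Let $M>K$. Suppose that the channel variances $\lambda_1,\dots,\lambda_K$ are independent random variables with common probability density $f_\lambda$ on $(0,\infty)$ and that, conditionally on $(\lambda_1,\dots,\lambda_K)$, the vectors $\mathbf h_1,\dots,\mathbf h_K$ are independent with $\mathbf h_k\sim\mathcal{CN}(\mathbf 0,\lambda_k\mathbf I_M)$ (Rayleigh fading). Then $\mathbf H^H\mathbf H$ is almost surely invertible. If, for almost every realization with $\mathbf H^H\mathbf H$ invertible, $\mathbf V$ is a ZF precoding matrix for $\mathbf H$ giving every user the rate $R$, then the average rate $\big(1-\frac KT\big)\mathbb E\big\{\log_2\big(1+\frac{|\mathbf h_k^H\mathbf v_k|^2}{\sum_{\ell\ne k}|\mathbf h_k^H\mathbf v_\ell|^2+\sigma^2}\big)\big\}$ of every user is also $R$, and the average total transmit power is $$\sum_{k=1}^K\mathbb E\{\|\mathbf v_k\|^2\}=\rho K A_\lambda,\qquad A_\lambda=\mathbb E\Big\{\frac{\sigma^2}{\lambda_k}\Big\}=\int_0^\infty\frac{\sigma^2}{x}f_\lambda(x)\,dx\quad\text{for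 every }k,$$ as an identity in $[0,\infty]$; in particular, if $A_\lambda<\infty$, all these expectations are finite. -/

import Mathlib

open MeasureTheory ProbabilityTheory
open scoped Matrix

noncomputable section

namespace ZFPrecoding

/-- `V = [v₁ … v_K]` is a zero-forcing precoding matrix for the channel matrix
`H = [h₁ … h_K]` (with `Hᴴ H` invertible): the pseudo-inverse `H (Hᴴ H)⁻¹`, whose `k`-th column is
scaled by an arbitrary complex gain `d k`. -/
def IsZF {M K : ℕ} (H V : Matrix (Fin M) (Fin K) ℂ) : Prop :=
  ∃ d : Fin K → ℂ, V = H * (Hᴴ * H)⁻¹ * Matrix.diagonal d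

/-- The zero-forcing precoding matrix `√(ρ σ² (M - K)) H (Hᴴ H)⁻¹`. -/
def zf {M K : ℕ} (ρ σ : ℝ) (H : Matrix (Fin M) (Fin K) ℂ) : Matrix (Fin M) (Fin K) ℂ :=
  ((Real.sqrt (ρ * σ ^ 2 * ((M : ℝ) - K)) : ℝ) : ℂ) • (H * (Hᴴ * H)⁻¹)

/-- The signal-to-interference-and-noise ratio of user `k`; note `(Hᴴ * V) k l = h_kᴴ v_l`. -/
def sinr {M K : ℕ} (σ : ℝ) (H V : Matrix (Fin M) (Fin K) ℂ) (k : Fin K) : ℝ :=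
  ‖(Hᴴ * V) k k‖ ^ 2 / ((∑ l ∈ Finset.univ.erase k, ‖(Hᴴ * V) k l‖ ^ 2) + σ ^ 2)

/-- The information rate of user `k` for one channel realization, with pilot overhead `K / T`. -/
def rate {M K : ℕ} (T : ℕ) (σ : ℝ) (H V : Matrix (Fin M) (Fin K) ℂ) (k : Fin K) : ℝ :=
  (1 - (K : ℝ) / T) * Real.logb 2 (1 + sinr σ H V k)

/-- The average information rate of user `k` for random channel and precoding matrices. -/
def avgRate {M K : ℕ} {Ω : Type*} [MeasurableSpace Ω] (μ : Measure Ω) (T : ℕ) (σ : ℝ)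
    (H V : Ω → Matrix (Fin M) (Fin K) ℂ) (k : Fin K) : ℝ :=
  (1 - (K : ℝ) / T) * ∫ ω, Real.logb 2 (1 + sinr σ (H ω) (V ω) k) ∂μ

/-- The transmit power `‖v_k‖²` (Euclidean norm) spent on user `k`. -/
def power {M K : ℕ} (V : Matrix (Fin M) (Fin K) ℂ) (k : Fin K) : ℝ :=
  ‖WithLp.toLp 2 (fun m => V m k)‖ ^ 2

/-- The circularly symmetric complex Gaussian distribution `CN(0, v)` on `ℂ`: independent real and
imaginary parts, each of law `N(0, v / 2)`. -/
def complexGaussian (v : ℝ) : Measure ℂ :=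
  ((gaussianReal 0 (v / 2).toNNReal).prod (gaussianReal 0 (v / 2).toNNReal)).map
    (fun p : ℝ × ℝ => (⟨p.1, p.2⟩ : ℂ))

/-- The law of `(h₁, …, h_K)` with independent `h_k ~ CN(0, v_k I_M)`. -/
def rayleighLaw (M : ℕ) {K : ℕ} (v : Fin K → ℝ) : Measure (Fin K → Fin M → ℂ) :=
  Measure.pi fun k => Measure.pi fun _ => complexGaussian (v k)

/-- Rayleigh fading with random variances: conditionally on `(lam₁, …, lam_K)`, the columns of `H`
are independent and the `k`-th one has law `CN(0, lam_k I_M)`. -/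
def IsRayleighFading {M K : ℕ} {Ω : Type*} [MeasurableSpace Ω] (μ : Measure Ω)
    (lam : Fin K → Ω → ℝ) (H : Ω → Matrix (Fin M) (Fin K) ℂ) : Prop :=
  ∀ A : Set (Fin K → ℝ), MeasurableSet A → ∀ B : Set (Fin K → Fin M → ℂ), MeasurableSet B →
    μ {ω | (fun k => lam k ω) ∈ A ∧ (fun k m => H ω m k) ∈ B} =
      ∫⁻ ω in {ω | (fun k => lam k ω) ∈ A}, rayleighLaw M (fun k => lam k ω) B ∂μ

/-- `f` is a probability density on `(0, ∞)` of the real random variable `X`. -/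
def HasPosDensity {Ω : Type*} [MeasurableSpace Ω] (μ : Measure Ω) (X : Ω → ℝ) (f : ℝ → ℝ) : Prop :=
  μ.map X = (volume.restrict (Set.Ioi 0)).withDensity (fun x => ENNReal.ofReal (f x))

/-- `A_λ = ∫₀^∞ (σ² / x) f(x) dx` as a real number (meaningful when the integral converges). -/
def propConst (σ : ℝ) (f : ℝ → ℝ) : ℝ :=
  ∫ x in Set.Ioi (0 : ℝ), σ ^ 2 / x * f x

/-- `A_λ = ∫₀^∞ (σ² / x) f(x) dx` as an element of `[0, ∞]`. -/
def propConstENN (σ : ℝ) (f : ℝ → ℝ) : ENNReal :=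
  ∫⁻ x in Set.Ioi (0 : ℝ), ENNReal.ofReal (σ ^ 2 / x * f x)

end ZFPrecoding

end

/-!
Zero forcing makes `Hᴴ V` diagonal, so the rate of user `k` determines `|d k| ^ 2`, and the power
spent on that user is `|d k| ^ 2` times the `k`-th diagonal entry of `(Hᴴ H)⁻¹`. This entry is the
inverse squared distance of `h_k` from the span of the other columns. Under Rayleigh fading and
conditionally on the variances, that distance is the norm of the projection of `h_k` to a subspace
of complex dimension `M - K + 1`, independent of `h_k`. Up to the factor `λ_k / 2`, its square is
the squared norm of a standard Gaussian vector of real dimension `2 (M - K + 1)`, whose inverse has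
mean `1 / (2 (M - K))`, as one sees by integrating `‖x‖⁻² = ∫₀^∞ exp (-t ‖x‖ ^ 2) dt`.
-/

namespace ZFPrecoding

open Module

section StdGaussian

variable {E : Type*} [NormedAddCommGroup E] [InnerProductSpace ℝ E] [FiniteDimensional ℝ E]
  [MeasurableSpace E] [BorelSpace E]

lemma stdGaussian_map_orthogonalProjectionOnto (U : Submodule ℝ E) :
    (stdGaussian E).map U.orthogonalProjectionOnto = stdGaussian U := by
  refine Measure.ext_of_charFun (funext fun t => ?_)
  rw [charFun_apply, integral_map (by fun_prop) (by fun_prop)]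
  simp_rw [Submodule.inner_orthogonalProjectionOnto_eq_of_mem_right]
  rw [← charFun_apply, charFun_stdGaussian, charFun_stdGaussian, Submodule.coe_norm]

lemma pi_stdGaussian_map_toLp {ι : Type*} [Fintype ι] :
    (Measure.pi fun _ : ι => stdGaussian E).map (WithLp.toLp 2) =
      stdGaussian (PiLp 2 fun _ : ι => E) := by
  refine Measure.ext_of_charFun (E := PiLp 2 fun _ : ι => E) (funext fun t => ?_)
  simp_rw [charFun_pi, charFun_stdGaussian, ← Complex.exp_sum, ← Complex.ofReal_pow,
    PiLp.norm_sq_eq_of_L2]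
  push_cast
  rw [← Finset.sum_div, Finset.sum_neg_distrib]

lemma stdGaussian_submodule_eq_zero {W : Submodule ℝ E} (hW : W ≠ ⊤) :
    stdGaussian E (W : Set E) = 0 := by
  obtain ⟨u, huW, hu⟩ := Submodule.exists_mem_ne_zero_of_ne_bot
    (mt Submodule.orthogonal_eq_bot_iff.1 hW)
  have hvar : Var[innerSL ℝ u; stdGaussian E].toNNReal ≠ 0 := by
    rw [variance_dual_stdGaussian, innerSL_apply_norm]
    simpa using hu
  have := nullSingletonClass_gaussianReal (μ := (stdGaussian E)[innerSL ℝ u]) hvar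
  refine measure_mono_null (t := innerSL ℝ u ⁻¹' {0}) (fun w hw => ?_) ?_
  · exact Submodule.inner_left_of_mem_orthogonal hw huW
  · rw [← Measure.map_apply (by fun_prop) (measurableSet_singleton 0),
      IsGaussian.map_eq_gaussianReal]
    exact measure_singleton 0

lemma integral_exp_neg_mul_sq_gaussianReal {t : ℝ} (ht : 0 ≤ t) :
    ∫ x, Real.exp (-t * x ^ 2) ∂gaussianReal 0 1 = (1 + 2 * t) ^ (-(1 / 2) : ℝ) := by
  have hdensity : ∀ x : ℝ, gaussianPDFReal 0 1 x * Real.exp (-t * x ^ 2) =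
      (√(2 * Real.pi))⁻¹ * Real.exp (-((1 + 2 * t) / 2) * x ^ 2) := fun x => by
    rw [gaussianPDFReal, mul_assoc, ← Real.exp_add]
    congr 2
    · simp
    · simp; ring
  have hscale : Real.pi / ((1 + 2 * t) / 2) = 2 * Real.pi / (1 + 2 * t) := by field_simp
  rw [integral_gaussianReal_eq_integral_smul one_ne_zero]
  simp_rw [smul_eq_mul, hdensity]
  rw [integral_const_mul, integral_gaussian, hscale, Real.sqrt_div (by positivity),
    Real.rpow_neg (by positivity), ← Real.sqrt_eq_rpow]
  field_simp

lemma integral_exp_neg_mul_norm_sq_stdGaussian {t : ℝ} (ht : 0 ≤ t) :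
    ∫ x, Real.exp (-t * ‖x‖ ^ 2) ∂stdGaussian E = (1 + 2 * t) ^ (-(finrank ℝ E / 2 : ℝ)) := by
  have hnorm : ∀ x : Fin (finrank ℝ E) → ℝ,
      ‖∑ i, x i • stdOrthonormalBasis ℝ E i‖ ^ 2 = ∑ i, x i ^ 2 := fun x => by
    rw [← real_inner_self_eq_norm_sq, (stdOrthonormalBasis ℝ E).orthonormal.inner_sum]
    simp [pow_two]
  rw [stdGaussian, integral_map (Measurable.aemeasurable (by fun_prop)) (by fun_prop)]
  simp_rw [hnorm, Finset.mul_sum, Real.exp_sum]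
  rw [integral_fintype_prod_eq_prod fun (_ : Fin (finrank ℝ E)) (x : ℝ) => Real.exp (-t * x ^ 2)]
  simp_rw [integral_exp_neg_mul_sq_gaussianReal ht]
  rw [Finset.prod_const, Finset.card_univ, Fintype.card_fin,
    ← Real.rpow_mul_natCast (by positivity)]
  ring_nf

lemma lintegral_Ioi_one_add_mul_rpow_neg {c s : ℝ} (hc : 0 < c) (hs : 1 < s) :
    ∫⁻ t in Set.Ioi (0 : ℝ), ENNReal.ofReal ((1 + c * t) ^ (-s)) =
      ENNReal.ofReal ((c * (s - 1))⁻¹) := by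
  have hs' : s - 1 ≠ 0 := (sub_pos.2 hs).ne'
  have hderiv : ∀ t ∈ Set.Ici (0 : ℝ), HasDerivAt
      (fun t => -(c * (s - 1))⁻¹ * (1 + c * t) ^ (-(s - 1))) ((1 + c * t) ^ (-s)) t := by
    intro t (ht : 0 ≤ t)
    have hlin : HasDerivAt (fun t => 1 + c * t) c t := by
      simpa using ((hasDerivAt_id t).const_mul c).const_add 1
    refine ((hlin.rpow_const (Or.inl (by positivity))).const_mul _).congr_deriv ?_
    rw [show -(s - 1) - 1 = -s by ring]
    field_simp
  have hlim : Filter.Tendsto (fun t => -(c * (s - 1))⁻¹ * (1 + c * t) ^ (-(s - 1)))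
      Filter.atTop (nhds 0) := by
    have hlin : Filter.Tendsto (fun t => 1 + c * t) Filter.atTop Filter.atTop :=
      Filter.tendsto_atTop_add_const_left _ _ (Filter.tendsto_id.const_mul_atTop hc)
    simpa using ((tendsto_rpow_neg_atTop (sub_pos.2 hs)).comp hlin).const_mul (-(c * (s - 1))⁻¹)
  have hnonneg : ∀ t ∈ Set.Ioi (0 : ℝ), 0 ≤ (1 + c * t) ^ (-s) := by
    intro t (ht : 0 < t)
    positivity
  rw [← ofReal_integral_eq_lintegral_ofReal
      (integrableOn_Ioi_deriv_of_nonneg' hderiv hnonneg hlim)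
      ((ae_restrict_iff' measurableSet_Ioi).2 (ae_of_all _ hnonneg)),
    integral_Ioi_of_hasDerivAt_of_nonneg' hderiv hnonneg hlim]
  simp

lemma lintegral_Ioi_exp_neg_mul {x : ℝ} (hx : 0 ≤ x) :
    ∫⁻ t in Set.Ioi (0 : ℝ), ENNReal.ofReal (Real.exp (-t * x)) = (ENNReal.ofReal x)⁻¹ := by
  rcases hx.eq_or_lt with rfl | hx
  · simp
  · simp_rw [neg_mul, mul_comm _ x, ← neg_mul]
    rw [← ofReal_integral_eq_lintegral_ofReal (exp_neg_integrableOn_Ioi 0 hx)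
      (ae_of_all _ fun t => (Real.exp_pos _).le), integral_exp_mul_Ioi (neg_lt_zero.2 hx),
      ← ENNReal.ofReal_inv_of_pos hx]
    simp

lemma lintegral_inv_norm_sq_stdGaussian (hE : 2 < finrank ℝ E) :
    ∫⁻ x, (ENNReal.ofReal (‖x‖ ^ 2))⁻¹ ∂stdGaussian E =
      ENNReal.ofReal ((finrank ℝ E - 2 : ℝ)⁻¹) := by
  have hd : (1 : ℝ) < finrank ℝ E / 2 := by
    rw [lt_div_iff₀ two_pos, one_mul]
    exact_mod_cast hE
  calc ∫⁻ x, (ENNReal.ofReal (‖x‖ ^ 2))⁻¹ ∂stdGaussian E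
      = ∫⁻ t in Set.Ioi (0 : ℝ), ∫⁻ x, ENNReal.ofReal (Real.exp (-t * ‖x‖ ^ 2))
          ∂stdGaussian E := by
        simp_rw [← lintegral_Ioi_exp_neg_mul (sq_nonneg ‖_‖)]
        exact lintegral_lintegral_swap (by fun_prop)
    _ = ∫⁻ t in Set.Ioi (0 : ℝ), ENNReal.ofReal ((1 + 2 * t) ^ (-(finrank ℝ E / 2 : ℝ))) := by
        refine setLIntegral_congr_fun measurableSet_Ioi fun t (ht : 0 < t) => ?_
        have hint : Integrable (fun x : E => Real.exp (-t * ‖x‖ ^ 2)) (stdGaussian E) :=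
          .of_bound (by fun_prop) 1 (ae_of_all _ fun x => by
            rw [Real.norm_of_nonneg (Real.exp_pos _).le, Real.exp_le_one_iff, neg_mul,
              neg_nonpos]
            positivity)
        rw [← integral_exp_neg_mul_norm_sq_stdGaussian ht.le, ofReal_integral_eq_lintegral_ofReal
          hint (ae_of_all _ fun x => (Real.exp_pos _).le)]
    _ = ENNReal.ofReal ((finrank ℝ E - 2 : ℝ)⁻¹) := by
        rw [lintegral_Ioi_one_add_mul_rpow_neg two_pos hd]
        ring_nf

end StdGaussian

lemma infDist_eq_norm_starProjection_orthogonal {𝕜 E : Type*} [RCLike 𝕜] [NormedAddCommGroup E]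
    [InnerProductSpace 𝕜 E] (W : Submodule 𝕜 E) [W.HasOrthogonalProjection] (x : E) :
    Metric.infDist x W = ‖Wᗮ.starProjection x‖ := by
  rw [Submodule.starProjection_orthogonal_val, Submodule.starProjection_minimal,
    Metric.infDist_eq_iInf]
  simp_rw [dist_eq_norm]
  rfl

lemma lintegral_inv_infDist_sq_stdGaussian {E : Type*} [NormedAddCommGroup E]
    [InnerProductSpace ℝ E] [FiniteDimensional ℝ E] [MeasurableSpace E] [BorelSpace E]
    {W : Submodule ℝ E} (hW : finrank ℝ W + 2 < finrank ℝ E) :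
    ∫⁻ x, (ENNReal.ofReal (Metric.infDist x W ^ 2))⁻¹ ∂stdGaussian E =
      ENNReal.ofReal ((finrank ℝ E - finrank ℝ W - 2 : ℝ)⁻¹) := by
  have hdim : finrank ℝ W + finrank ℝ Wᗮ = finrank ℝ E := W.finrank_add_finrank_orthogonal
  simp_rw [infDist_eq_norm_starProjection_orthogonal, Submodule.starProjection_apply,
    ← Submodule.coe_norm]
  rw [← hdim, Nat.cast_add, add_sub_cancel_left,
    ← lintegral_inv_norm_sq_stdGaussian (by omega), ← stdGaussian_map_orthogonalProjectionOnto,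
    lintegral_map (by fun_prop) (by fun_prop)]

section Gram

open Matrix

variable {𝕜 E ι : Type*} [RCLike 𝕜] [NormedAddCommGroup E] [InnerProductSpace 𝕜 E]

lemma continuous_gram : Continuous fun v : ι → E => gram 𝕜 v :=
  continuous_matrix fun i j => by
    simp only [gram_apply]
    fun_prop

variable [Fintype ι] [DecidableEq ι]

lemma measurable_inv_gram_apply [MeasurableSpace E] [OpensMeasurableSpace E]
    [SecondCountableTopology E] (i j : ι) : Measurable fun v : ι → E => (gram 𝕜 v)⁻¹ i j := by
  simp_rw [inv_def, Matrix.smul_apply, Ring.inverse_eq_inv', smul_eq_mul]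
  exact continuous_gram.matrix_det.measurable.inv.mul
    (continuous_gram.matrix_adjugate.matrix_elem i j).measurable

lemma inv_gram_apply_self_mul_infDist_sq {v : ι → E} (hv : LinearIndependent 𝕜 v) (k : ι) :
    (gram 𝕜 v)⁻¹ k k *
      ((Metric.infDist (v k) (Submodule.span 𝕜 (v '' {k}ᶜ)) ^ 2 : ℝ) : 𝕜) = 1 := by
  set W := Submodule.span 𝕜 (v '' {k}ᶜ)
  have : FiniteDimensional 𝕜 W := .span_of_finite 𝕜 (Set.toFinite _)
  set u := Wᗮ.starProjection (v k)
  have huW : u ∈ Wᗮ := Submodule.starProjection_apply_mem _ _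
  have hproj : W.starProjection (v k) ∈ W := Submodule.starProjection_apply_mem _ _
  obtain ⟨c, hc, hcomb⟩ := (Finsupp.mem_span_image_iff_linearCombination 𝕜).1 hproj
  have hck : c k = 0 := (Finsupp.mem_supported' 𝕜 c).1 hc k (by simp)
  have hu : ∑ i, (Pi.single k 1 - ⇑c : ι → 𝕜) i • v i = u := by
    rw [Finsupp.linearCombination_apply, Finsupp.sum_fintype _ _ (by simp)] at hcomb
    simp [u, sub_smul, Pi.single_apply, ite_smul, ← hcomb, Finset.sum_sub_distrib,
      Submodule.starProjection_orthogonal_val]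
  have hgram : gram 𝕜 v *ᵥ (Pi.single k 1 - ⇑c) = Pi.single k ((‖u‖ ^ 2 : ℝ) : 𝕜) := by
    ext l
    trans inner 𝕜 (v l) u
    · simp_rw [← hu, inner_sum, inner_smul_right, mulVec, dotProduct, gram_apply, mul_comm]
    rcases eq_or_ne l k with rfl | hl
    · rw [Pi.single_eq_same, ← W.starProjection_add_starProjection_orthogonal (v l),
        inner_add_left, Submodule.inner_right_of_mem_orthogonal hproj huW, zero_add,
        inner_self_eq_norm_sq_to_K, RCLike.ofReal_pow]
    · rw [Pi.single_eq_of_ne hl]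
      exact Submodule.inner_right_of_mem_orthogonal
        (Submodule.subset_span (Set.mem_image_of_mem v hl)) huW
  have hdet : IsUnit (gram 𝕜 v).det := (det_gram_ne_zero_iff_linearIndependent.2 hv).isUnit
  have hinv := congrFun (congrArg ((gram 𝕜 v)⁻¹ *ᵥ ·) hgram) k
  simp only [mulVec_mulVec, nonsing_inv_mul _ hdet, one_mulVec, mulVec_single] at hinv
  rw [infDist_eq_norm_starProjection_orthogonal]
  change _ * ((‖u‖ ^ 2 : ℝ) : 𝕜) = 1
  simpa [hck] using hinv.symm

lemma gram_smul (c : ι → 𝕜) (v : ι → E) :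
    gram 𝕜 (c • v) = diagonal (star c) * gram 𝕜 v * diagonal c := by
  ext i j
  simp [inner_smul_left, inner_smul_right, mul_comm]

lemma inv_gram_smul_apply_self {c : ι → 𝕜} (hc : ∀ i, c i ≠ 0) (v : ι → E) (k : ι) :
    (gram 𝕜 (c • v))⁻¹ k k = (((‖c k‖ ^ 2)⁻¹ : ℝ) : 𝕜) * (gram 𝕜 v)⁻¹ k k := by
  have hinv : (diagonal c)⁻¹ = diagonal c⁻¹ := by
    refine inv_eq_left_inv ?_
    simp [diagonal_mul_diagonal, hc]
  have hinv' : (diagonal (star c))⁻¹ = diagonal (star c⁻¹) := by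
    rw [← diagonal_conjTranspose, ← conjTranspose_nonsing_inv, hinv, diagonal_conjTranspose]
  rw [gram_smul, Matrix.mul_inv_rev, Matrix.mul_inv_rev, hinv, hinv', diagonal_mul, mul_diagonal,
    ← mul_assoc, mul_right_comm]
  simp [← RCLike.conj_mul]

lemma ofReal_re_inv_gram_apply_self {v : ι → E} (hv : LinearIndependent 𝕜 v) (k : ι) :
    ENNReal.ofReal (RCLike.re ((gram 𝕜 v)⁻¹ k k)) =
      (ENNReal.ofReal (Metric.infDist (v k) (Submodule.span 𝕜 (v '' {k}ᶜ)) ^ 2))⁻¹ := by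
  have hmul := inv_gram_apply_self_mul_infDist_sq hv k
  have hdist : Metric.infDist (v k) (Submodule.span 𝕜 (v '' {k}ᶜ)) ^ 2 ≠ 0 := fun h => by
    simp [h] at hmul
  rw [eq_inv_of_mul_eq_one_left hmul, ← RCLike.ofReal_inv, RCLike.ofReal_re,
    ENNReal.ofReal_inv_of_pos (lt_of_le_of_ne' (sq_nonneg _) hdist)]

end Gram

section RandomFamily

lemma measurePreserving_update {ι : Type*} [Fintype ι] [DecidableEq ι] {α : ι → Type*}
    [∀ i, MeasurableSpace (α i)] (ν : ∀ i, Measure (α i)) [∀ i, SigmaFinite (ν i)] (k : ι)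
    [IsProbabilityMeasure (ν k)] :
    MeasurePreserving (fun p : (∀ i, α i) × α k => Function.update p.1 k p.2)
      ((Measure.pi ν).prod (ν k)) (Measure.pi ν) where
  measurable := measurable_update'
  map_eq := by
    refine (Measure.pi_eq fun s hs => ?_).symm
    have hpre : (fun p : (∀ i, α i) × α k => Function.update p.1 k p.2) ⁻¹' Set.univ.pi s =
        Set.univ.pi (Function.update s k Set.univ) ×ˢ s k := by
      ext p
      simp only [Set.mem_preimage, Set.mem_prod, Set.mem_pi]
      grind
    rw [Measure.map_apply measurable_update' (.univ_pi hs), hpre, Measure.prod_prod,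
      Measure.pi_pi, ← Finset.prod_erase_mul _ _ (Finset.mem_univ k),
      ← Finset.prod_erase_mul _ (fun i => ν i (s i)) (Finset.mem_univ k), Function.update_self,
      measure_univ, mul_one]
    congr 1
    exact Finset.prod_congr rfl fun i hi => by
      rw [Function.update_of_ne (Finset.ne_of_mem_erase hi)]

variable {𝕜 E ι : Type*} [RCLike 𝕜] [NormedAddCommGroup E] [NormedSpace 𝕜 E]
  [FiniteDimensional 𝕜 E] [MeasurableSpace E] [BorelSpace E]

lemma measurableSet_linearIndepOn (s : Finset ι) :
    MeasurableSet {z : ι → E | LinearIndepOn 𝕜 z s} := by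
  have := FiniteDimensional.proper_rclike 𝕜 E
  have hopen : IsOpen {z : s → E | LinearIndependent 𝕜 z} := isOpen_setOfPred_linearIndependent
  exact (measurable_pi_lambda _ fun i => measurable_pi_apply _ :
    Measurable fun (z : ι → E) (i : s) => z i) hopen.measurableSet

variable [Fintype ι]

lemma ae_pi_linearIndependent {ν : ι → Measure E} [∀ i, IsProbabilityMeasure (ν i)]
    (hν : ∀ i, ∀ W : Submodule 𝕜 E, W ≠ ⊤ → ν i W = 0) (hι : Fintype.card ι ≤ finrank 𝕜 E) :
    ∀ᵐ z ∂Measure.pi ν, LinearIndependent 𝕜 z := by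
  classical
  suffices ∀ s : Finset ι, ∀ᵐ z ∂Measure.pi ν, LinearIndepOn 𝕜 z s by
    simpa [linearIndepOn_univ_iff] using this Finset.univ
  intro s
  induction s using Finset.induction_on with
  | empty => simp
  | insert k s hk ih =>
    have hupd := measurePreserving_update ν k
    have hmeas := measurableSet_linearIndepOn (𝕜 := 𝕜) (E := E) (insert k s)
    rw [← hupd.map_eq, ae_map_iff hupd.aemeasurable hmeas]
    refine (Measure.ae_prod_iff_ae_ae (hupd.measurable hmeas)).2 ?_
    filter_upwards [ih] with z hz
    have hspan : Submodule.span 𝕜 (z '' s) ≠ ⊤ := by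
      intro htop
      have hle := (finrank_span_finset_le_card (R := 𝕜) (s.image z)).trans Finset.card_image_le
      rw [Finset.coe_image, Set.finrank, htop, finrank_top] at hle
      exact hk ((Finset.card_eq_iff_eq_univ s).1
        (le_antisymm (Finset.card_le_univ s) (hι.trans hle)) ▸ Finset.mem_univ k)
    filter_upwards [measure_eq_zero_iff_ae_notMem.1 (hν k _ hspan)] with y hy
    have hs : Set.EqOn (Function.update z k y) z s :=
      fun i hi => Function.update_of_ne (ne_of_mem_of_not_mem hi hk) _ _
    rw [Finset.coe_insert, linearIndepOn_insert (by exact_mod_cast hk), Function.update_self,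
      Set.image_congr hs]
    exact ⟨hz.congr hs.symm, hy⟩

end RandomFamily

section Wishart

open Matrix

lemma finrank_span_image_compl_singleton {R E ι : Type*} [Ring R] [Nontrivial R]
    [StrongRankCondition R] [AddCommGroup E] [Module R E] [Fintype ι] {v : ι → E}
    (hv : LinearIndependent R v) (k : ι) :
    finrank R (Submodule.span R (v '' {k}ᶜ)) + 1 = Fintype.card ι := by
  classical
  have hcompl : LinearIndependent R fun i : ({k}ᶜ : Set ι) => v i :=
    hv.comp _ Subtype.val_injective
  rw [Set.image_eq_range, finrank_span_eq_card hcompl, Fintype.card_compl_set,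
    Set.card_singleton]
  exact Nat.sub_add_cancel (Fintype.card_pos_iff.2 ⟨k⟩)

variable {𝕜 E ι : Type*} [RCLike 𝕜] [NormedAddCommGroup E] [InnerProductSpace 𝕜 E]
  [InnerProductSpace ℝ E] [IsScalarTower ℝ 𝕜 E] [FiniteDimensional ℝ E] [MeasurableSpace E]
  [BorelSpace E] [Fintype ι]

lemma ae_pi_stdGaussian_linearIndependent (hι : Fintype.card ι ≤ finrank 𝕜 E) :
    ∀ᵐ v ∂Measure.pi fun _ : ι => stdGaussian E, LinearIndependent 𝕜 v := by
  have := FiniteDimensional.right ℝ 𝕜 E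
  exact ae_pi_linearIndependent
    (fun _ W hW => stdGaussian_submodule_eq_zero (W := W.restrictScalars ℝ) (by simpa)) hι

variable [DecidableEq ι]

lemma lintegral_inv_gram_update_apply_self_stdGaussian {v : ι → E} (hv : LinearIndependent 𝕜 v)
    (k : ι) (hvx : ∀ᵐ x ∂stdGaussian E, LinearIndependent 𝕜 (Function.update v k x))
    (hι : finrank ℝ 𝕜 * Fintype.card ι + 2 < finrank ℝ 𝕜 * (finrank 𝕜 E + 1)) :
    ∫⁻ x, ENNReal.ofReal (RCLike.re ((gram 𝕜 (Function.update v k x))⁻¹ k k)) ∂stdGaussian E =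
      ENNReal.ofReal ((finrank ℝ 𝕜 * (finrank 𝕜 E + 1 - Fintype.card ι) - 2 : ℝ)⁻¹) := by
  set W := Submodule.span 𝕜 (v '' {k}ᶜ)
  have hspan : finrank 𝕜 W + 1 = Fintype.card ι := finrank_span_image_compl_singleton hv k
  have hW : finrank ℝ (W.restrictScalars ℝ) = finrank ℝ 𝕜 * finrank 𝕜 W :=
    (finrank_mul_finrank ℝ 𝕜 W).symm
  have hE : finrank ℝ E = finrank ℝ 𝕜 * finrank 𝕜 E := (finrank_mul_finrank ℝ 𝕜 E).symm
  have hlt : finrank ℝ (W.restrictScalars ℝ) + 2 < finrank ℝ E := by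
    rw [hW, hE]
    rw [← hspan] at hι
    linarith
  calc ∫⁻ x, ENNReal.ofReal (RCLike.re ((gram 𝕜 (Function.update v k x))⁻¹ k k)) ∂stdGaussian E
      = ∫⁻ x, (ENNReal.ofReal (Metric.infDist x (W.restrictScalars ℝ) ^ 2))⁻¹ ∂stdGaussian E := by
        refine lintegral_congr_ae ?_
        filter_upwards [hvx] with x hx
        have himage : Function.update v k x '' {k}ᶜ = v '' {k}ᶜ :=
          Set.image_congr fun i hi => Function.update_of_ne hi x v
        rw [ofReal_re_inv_gram_apply_self hx, Function.update_self, himage]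
        rfl
    _ = ENNReal.ofReal ((finrank ℝ 𝕜 * (finrank 𝕜 E + 1 - Fintype.card ι) - 2 : ℝ)⁻¹) := by
        rw [lintegral_inv_infDist_sq_stdGaussian hlt, hW, hE, ← hspan]
        push_cast
        ring_nf

lemma lintegral_inv_gram_apply_self_pi_stdGaussian
    (hι : finrank ℝ 𝕜 * Fintype.card ι + 2 < finrank ℝ 𝕜 * (finrank 𝕜 E + 1)) (k : ι) :
    ∫⁻ v, ENNReal.ofReal (RCLike.re ((gram 𝕜 v)⁻¹ k k)) ∂Measure.pi (fun _ => stdGaussian E) =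
      ENNReal.ofReal ((finrank ℝ 𝕜 * (finrank 𝕜 E + 1 - Fintype.card ι) - 2 : ℝ)⁻¹) := by
  have hcard : Fintype.card ι ≤ finrank 𝕜 E :=
    Nat.lt_succ_iff.1 (lt_of_mul_lt_mul_left' ((Nat.le_add_right _ 2).trans_lt hι))
  have hae : ∀ᵐ v ∂Measure.pi fun _ : ι => stdGaussian E, LinearIndependent 𝕜 v :=
    ae_pi_stdGaussian_linearIndependent hcard
  have hupd := measurePreserving_update (fun _ : ι => stdGaussian E) k
  have hmeas : Measurable fun v : ι → E => ENNReal.ofReal (RCLike.re ((gram 𝕜 v)⁻¹ k k)) :=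
    (RCLike.measurable_re.comp (measurable_inv_gram_apply k k)).ennreal_ofReal
  rw [← hupd.lintegral_comp hmeas]
  refine (lintegral_prod _ (hmeas.comp hupd.measurable).aemeasurable).trans ?_
  rw [lintegral_congr_ae (g := fun _ => ENNReal.ofReal
    ((finrank ℝ 𝕜 * (finrank 𝕜 E + 1 - Fintype.card ι) - 2 : ℝ)⁻¹))]
  · simp
  · filter_upwards [hae, Measure.ae_ae_of_ae_prod (hupd.quasiMeasurePreserving.ae hae)]
      with v hv hvx
    exact lintegral_inv_gram_update_apply_self_stdGaussian hv k hvx hι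

end Wishart

section Columns

open Matrix

/-- The columns of a matrix as vectors of a Euclidean space. It gives the Gram matrix `Hᴴ * H` of
a channel matrix its geometric meaning, which `Matrix.col` does not since `Fin M → ℂ` carries the
sup norm. -/
def columns {M K : ℕ} (H : Matrix (Fin M) (Fin K) ℂ) (k : Fin K) : EuclideanSpace ℂ (Fin M) :=
  WithLp.toLp 2 (H.col k)

variable {M K : ℕ} {H : Matrix (Fin M) (Fin K) ℂ}

lemma gram_columns (H : Matrix (Fin M) (Fin K) ℂ) : gram ℂ (columns H) = Hᴴ * H := by
  ext i j
  simp [columns, mul_apply, PiLp.inner_apply, mul_comm]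

lemma isUnit_conjTranspose_mul_self_iff :
    IsUnit (Hᴴ * H) ↔ LinearIndependent ℂ (columns H) := by
  rw [← gram_columns, isUnit_iff_isUnit_det, isUnit_iff_ne_zero,
    det_gram_ne_zero_iff_linearIndependent]

lemma le_of_isUnit_conjTranspose_mul_self (hH : IsUnit (Hᴴ * H)) : K ≤ M := by
  simpa using (isUnit_conjTranspose_mul_self_iff.1 hH).fintype_card_le_finrank

end Columns

section RayleighLaw

lemma gaussianReal_zero_eq_map_sqrt_mul (v : ℝ) :
    gaussianReal 0 v.toNNReal = (gaussianReal 0 1).map (√v * ·) := by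
  rw [gaussianReal_map_const_mul, mul_zero, mul_one]
  congr
  ext
  simp [Real.sq_sqrt']

lemma measurable_complex_mk : Measurable fun p : ℝ × ℝ => (⟨p.1, p.2⟩ : ℂ) :=
  Complex.measurableEquivRealProd.symm.measurable

lemma map_prod_gaussianReal_eq_stdGaussian_complex :
    ((gaussianReal 0 1).prod (gaussianReal 0 1)).map (fun p : ℝ × ℝ => (⟨p.1, p.2⟩ : ℂ)) =
      stdGaussian ℂ := by
  rw [stdGaussian_eq_map_pi_orthonormalBasis Complex.orthonormalBasisOneI,
    ← (measurePreserving_finTwoArrow (gaussianReal 0 1)).map_eq,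
    Measure.map_map measurable_complex_mk (by fun_prop)]
  congr 1
  funext x
  simp [Complex.ext_iff]

lemma measurePreserving_smul_complexGaussian (v : ℝ) :
    MeasurePreserving (((√(v / 2) : ℝ) : ℂ) • ·) (stdGaussian ℂ) (complexGaussian v) where
  measurable := by fun_prop
  map_eq := by
    rw [complexGaussian, gaussianReal_zero_eq_map_sqrt_mul,
      Measure.map_prod_map _ _ (by fun_prop) (by fun_prop),
      Measure.map_map measurable_complex_mk (by fun_prop),
      ← map_prod_gaussianReal_eq_stdGaussian_complex,
      Measure.map_map (by fun_prop) measurable_complex_mk]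
    congr 1
    funext p
    simp [Complex.ext_iff]

instance (v : ℝ) : IsProbabilityMeasure (complexGaussian v) :=
  Measure.isProbabilityMeasure_map measurable_complex_mk.aemeasurable

lemma measurePreserving_smul_pi_complexGaussian (M : ℕ) (v : ℝ) :
    MeasurePreserving
      (fun x : EuclideanSpace ℂ (Fin M) => WithLp.ofLp (((√(v / 2) : ℝ) : ℂ) • x))
      (stdGaussian (EuclideanSpace ℂ (Fin M))) (Measure.pi fun _ => complexGaussian v) := by
  have htoLp : MeasurePreserving (MeasurableEquiv.toLp 2 (Fin M → ℂ))
      (Measure.pi fun _ => stdGaussian ℂ) (stdGaussian (EuclideanSpace ℂ (Fin M))) :=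
    ⟨(MeasurableEquiv.toLp 2 (Fin M → ℂ)).measurable, pi_stdGaussian_map_toLp⟩
  exact (measurePreserving_pi _ _ fun _ : Fin M => measurePreserving_smul_complexGaussian v).comp
    (htoLp.symm _)

lemma measurePreserving_smul_rayleighLaw (M : ℕ) {K : ℕ} (v : Fin K → ℝ) :
    MeasurePreserving
      (fun (x : Fin K → EuclideanSpace ℂ (Fin M)) k =>
        WithLp.ofLp (((√(v k / 2) : ℝ) : ℂ) • x k))
      (Measure.pi fun _ => stdGaussian (EuclideanSpace ℂ (Fin M))) (rayleighLaw M v) :=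
  measurePreserving_pi _ _ fun k => measurePreserving_smul_pi_complexGaussian M (v k)

end RayleighLaw

section ZeroForcing

variable {M K : ℕ} {H V : Matrix (Fin M) (Fin K) ℂ}

lemma conjTranspose_mul_zeroForcing (hH : IsUnit (Hᴴ * H)) (d : Fin K → ℂ) :
    Hᴴ * (H * (Hᴴ * H)⁻¹ * Matrix.diagonal d) = Matrix.diagonal d := by
  rw [← Matrix.mul_assoc, ← Matrix.mul_assoc,
    Matrix.mul_nonsing_inv _ ((Matrix.isUnit_iff_isUnit_det _).1 hH), Matrix.one_mul]

lemma sinr_zeroForcing (hH : IsUnit (Hᴴ * H)) (σ : ℝ) (d : Fin K → ℂ) (k : Fin K) :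
    sinr σ H (H * (Hᴴ * H)⁻¹ * Matrix.diagonal d) k = ‖d k‖ ^ 2 / σ ^ 2 := by
  rw [sinr, conjTranspose_mul_zeroForcing hH, Matrix.diagonal_apply_eq, Finset.sum_eq_zero,
    zero_add]
  intro l hl
  rw [Matrix.diagonal_apply_ne _ (Finset.ne_of_mem_erase hl).symm]
  simp

lemma ofReal_power (V : Matrix (Fin M) (Fin K) ℂ) (k : Fin K) :
    ((power V k : ℝ) : ℂ) = (Vᴴ * V) k k := by
  rw [← gram_columns, Matrix.gram_apply, inner_self_eq_norm_sq_to_K, power, Complex.ofReal_pow]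
  rfl

lemma ofReal_power_zeroForcing (hH : IsUnit (Hᴴ * H)) (d : Fin K → ℂ) (k : Fin K) :
    ((power (H * (Hᴴ * H)⁻¹ * Matrix.diagonal d) k : ℝ) : ℂ) =
      ((‖d k‖ ^ 2 : ℝ) : ℂ) * (Hᴴ * H)⁻¹ k k := by
  have hherm : ((Hᴴ * H)⁻¹)ᴴ = (Hᴴ * H)⁻¹ := (Matrix.isHermitian_conjTranspose_mul_self H).inv
  have hgram : (H * (Hᴴ * H)⁻¹ * Matrix.diagonal d)ᴴ * (H * (Hᴴ * H)⁻¹ * Matrix.diagonal d) =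
      Matrix.diagonal (star d) * (Hᴴ * H)⁻¹ * Matrix.diagonal d := by
    rw [Matrix.conjTranspose_mul, Matrix.conjTranspose_mul, hherm, Matrix.mul_assoc,
      Matrix.mul_assoc _ Hᴴ, conjTranspose_mul_zeroForcing hH, Matrix.diagonal_conjTranspose,
      Matrix.mul_assoc]
  rw [ofReal_power, hgram, Matrix.mul_diagonal, Matrix.diagonal_mul, mul_right_comm,
    Pi.star_apply, Complex.star_def, Complex.conj_mul', Complex.ofReal_pow]

lemma IsZF.ofReal_power_eq (hV : IsZF H V) (hH : IsUnit (Hᴴ * H)) {σ : ℝ} (hσ : σ ≠ 0)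
    (k : Fin K) :
    ((power V k : ℝ) : ℂ) = ((sinr σ H V k * σ ^ 2 : ℝ) : ℂ) * (Hᴴ * H)⁻¹ k k := by
  obtain ⟨d, rfl⟩ := hV
  rw [ofReal_power_zeroForcing hH, sinr_zeroForcing hH, div_mul_cancel₀ _ (pow_ne_zero 2 hσ)]

lemma sinr_nonneg (σ : ℝ) (H V : Matrix (Fin M) (Fin K) ℂ) (k : Fin K) : 0 ≤ sinr σ H V k := by
  unfold sinr
  positivity

lemma rate_eq_iff_sinr_eq {T : ℕ} (hKT : K < T) {σ x : ℝ} (hx : 0 ≤ x) {k : Fin K} :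
    rate T σ H V k = (1 - (K : ℝ) / T) * Real.logb 2 (1 + x) ↔ sinr σ H V k = x := by
  have hsinr := sinr_nonneg σ H V k
  have hT : (0 : ℝ) < T := by exact_mod_cast K.zero_le.trans_lt hKT
  have hoverhead : 1 - (K : ℝ) / T ≠ 0 :=
    (sub_pos.2 ((div_lt_one hT).2 (by exact_mod_cast hKT))).ne'
  have hinj := (Real.logb_injOn_pos one_lt_two).eq_iff
    (Set.mem_Ioi.2 (by positivity : 0 < 1 + sinr σ H V k))
    (Set.mem_Ioi.2 (by positivity : 0 < 1 + x))
  rw [rate, mul_right_inj' hoverhead, hinj, add_right_inj]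

lemma IsZF.ofReal_power_eq_of_rate_eq (hV : IsZF H V) (hH : IsUnit (Hᴴ * H)) {T : ℕ}
    (hKT : K < T) {σ x : ℝ} (hσ : σ ≠ 0) (hx : 0 ≤ x) {k : Fin K}
    (hrate : rate T σ H V k = (1 - (K : ℝ) / T) * Real.logb 2 (1 + x)) :
    ((power V k : ℝ) : ℂ) = ((x * σ ^ 2 : ℝ) : ℂ) * (Hᴴ * H)⁻¹ k k := by
  rw [hV.ofReal_power_eq hH hσ, (rate_eq_iff_sinr_eq hKT hx).1 hrate]

lemma IsZF.power_eq_of_rate_eq (hV : IsZF H V) (hH : IsUnit (Hᴴ * H)) {T : ℕ} (hKT : K < T)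
    {σ x : ℝ} (hσ : σ ≠ 0) (hx : 0 ≤ x) {k : Fin K}
    (hrate : rate T σ H V k = (1 - (K : ℝ) / T) * Real.logb 2 (1 + x)) :
    power V k = x * σ ^ 2 * ((Hᴴ * H)⁻¹ k k).re := by
  rw [← Complex.re_ofReal_mul, ← hV.ofReal_power_eq_of_rate_eq hH hKT hσ hx hrate,
    Complex.ofReal_re]

lemma IsZF.ofReal_sum_power_eq_of_rate_eq (hV : IsZF H V) (hH : IsUnit (Hᴴ * H)) {T : ℕ}
    (hKT : K < T) {σ x : ℝ} (hσ : σ ≠ 0) (hx : 0 ≤ x)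
    (hrate : ∀ k, rate T σ H V k = (1 - (K : ℝ) / T) * Real.logb 2 (1 + x)) :
    ((∑ k, power V k : ℝ) : ℂ) = ((x * σ ^ 2 : ℝ) : ℂ) * ((Hᴴ * H)⁻¹).trace := by
  rw [Complex.ofReal_sum, Matrix.trace, Finset.mul_sum]
  exact Finset.sum_congr rfl fun k _ => hV.ofReal_power_eq_of_rate_eq hH hKT hσ hx (hrate k)

lemma zf_eq_mul_diagonal (ρ σ : ℝ) (H : Matrix (Fin M) (Fin K) ℂ) :
    zf ρ σ H = H * (Hᴴ * H)⁻¹ *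
      Matrix.diagonal fun _ : Fin K => ((√(ρ * σ ^ 2 * ((M : ℝ) - K)) : ℝ) : ℂ) :=
  Matrix.smul_eq_mul_diagonal _ _

lemma isZF_zf (ρ σ : ℝ) (H : Matrix (Fin M) (Fin K) ℂ) : IsZF H (zf ρ σ H) :=
  ⟨_, zf_eq_mul_diagonal ρ σ H⟩

lemma conjTranspose_mul_zf_apply_self (hH : IsUnit (Hᴴ * H)) (ρ σ : ℝ) (k : Fin K) :
    (Hᴴ * zf ρ σ H) k k = ((√(ρ * σ ^ 2 * ((M : ℝ) - K)) : ℝ) : ℂ) := by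
  rw [zf_eq_mul_diagonal, conjTranspose_mul_zeroForcing hH, Matrix.diagonal_apply_eq]

lemma sinr_zf (hH : IsUnit (Hᴴ * H)) {ρ σ : ℝ} (hρ : 0 ≤ ρ) (hσ : σ ≠ 0) (k : Fin K) :
    sinr σ H (zf ρ σ H) k = ρ * ((M : ℝ) - K) := by
  have hMK : (0 : ℝ) ≤ (M : ℝ) - K :=
    sub_nonneg.2 (by exact_mod_cast le_of_isUnit_conjTranspose_mul_self hH)
  rw [zf_eq_mul_diagonal, sinr_zeroForcing hH, Complex.norm_real, Real.norm_eq_abs, sq_abs,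
    Real.sq_sqrt (by positivity)]
  field_simp

end ZeroForcing

section Fading

variable {M K : ℕ} {Ω : Type*} [MeasurableSpace Ω] {μ : Measure Ω}

lemma integrable_and_integral_eq_of_lintegral_ofReal_eq {g : Ω → ℝ} {a : ℝ}
    (hg : AEStronglyMeasurable g μ) (hg0 : 0 ≤ᵐ[μ] g) (ha : 0 ≤ a)
    (h : ∫⁻ ω, ENNReal.ofReal (g ω) ∂μ = ENNReal.ofReal a) :
    Integrable g μ ∧ ∫ ω, g ω ∂μ = a := by
  refine ⟨⟨hg, ?_⟩, ?_⟩
  · rw [hasFiniteIntegral_iff_ofReal hg0, h]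
    exact ENNReal.ofReal_lt_top
  · rw [integral_eq_lintegral_of_nonneg_ae hg0 hg, h, ENNReal.toReal_ofReal ha]

section PosDensity

variable {X : Ω → ℝ} {f : ℝ → ℝ}

lemma HasPosDensity.ae_pos (h : HasPosDensity μ X f) (hX : Measurable X) : ∀ᵐ ω ∂μ, 0 < X ω := by
  have hmap : ∀ᵐ x ∂(μ.map X), x ∈ Set.Ioi (0 : ℝ) := by
    rw [h]
    exact (withDensity_absolutelyContinuous _ _).ae_le (ae_restrict_mem measurableSet_Ioi)
  exact ae_of_ae_map hX.aemeasurable hmap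

lemma HasPosDensity.lintegral_div (h : HasPosDensity μ X f) (hX : Measurable X)
    (hf : Measurable f) (hf0 : ∀ x, 0 ≤ f x) (σ : ℝ) :
    ∫⁻ ω, ENNReal.ofReal (σ ^ 2 / X ω) ∂μ = propConstENN σ f := by
  have hdiv : Measurable fun x : ℝ => ENNReal.ofReal (σ ^ 2 / x) := by fun_prop
  rw [← lintegral_map hdiv hX, h, lintegral_withDensity_eq_lintegral_mul _ (by fun_prop) hdiv]
  refine lintegral_congr fun x => ?_
  rw [Pi.mul_apply, ← ENNReal.ofReal_mul (hf0 x), mul_comm]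

lemma propConst_integrand_nonneg (hf0 : ∀ x, 0 ≤ f x) (σ : ℝ) :
    0 ≤ᵐ[volume.restrict (Set.Ioi 0)] fun x => σ ^ 2 / x * f x := by
  filter_upwards [ae_restrict_mem measurableSet_Ioi] with x (hx : 0 < x)
  exact mul_nonneg (by positivity) (hf0 x)

lemma propConst_nonneg (hf0 : ∀ x, 0 ≤ f x) (σ : ℝ) : 0 ≤ propConst σ f :=
  integral_nonneg_of_ae (propConst_integrand_nonneg hf0 σ)

lemma propConstENN_eq_ofReal (hf0 : ∀ x, 0 ≤ f x) {σ : ℝ}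
    (hint : IntegrableOn (fun x => σ ^ 2 / x * f x) (Set.Ioi 0)) :
    propConstENN σ f = ENNReal.ofReal (propConst σ f) :=
  (ofReal_integral_eq_lintegral_ofReal hint (propConst_integrand_nonneg hf0 σ)).symm

lemma HasPosDensity.integrable_and_integral_div (h : HasPosDensity μ X f) (hX : Measurable X)
    (hf : Measurable f) (hf0 : ∀ x, 0 ≤ f x) {σ : ℝ}
    (hint : IntegrableOn (fun x => σ ^ 2 / x * f x) (Set.Ioi 0)) :
    Integrable (fun ω => σ ^ 2 / X ω) μ ∧ ∫ ω, σ ^ 2 / X ω ∂μ = propConst σ f := by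
  refine integrable_and_integral_eq_of_lintegral_ofReal_eq
    (hX.const_div _).aestronglyMeasurable ?_ (propConst_nonneg hf0 σ)
    ((h.lintegral_div hX hf hf0 σ).trans (propConstENN_eq_ofReal hf0 hint))
  filter_upwards [h.ae_pos hX] with ω hω using div_nonneg (sq_nonneg σ) hω.le

end PosDensity

variable {lam : Fin K → Ω → ℝ} {H V : Ω → Matrix (Fin M) (Fin K) ℂ}

lemma measurable_columns (hH : ∀ m k, Measurable fun ω => H ω m k) :
    Measurable fun ω => columns (H ω) :=
  measurable_pi_lambda _ fun k =>
    (WithLp.measurable_toLp 2 _).comp (measurable_pi_lambda _ fun m => hH m k)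

lemma measurable_re_inv_conjTranspose_mul_self_apply (hH : ∀ m k, Measurable fun ω => H ω m k)
    (i j : Fin K) : Measurable fun ω => (((H ω)ᴴ * H ω)⁻¹ i j).re := by
  simp_rw [← gram_columns]
  exact Complex.measurable_re.comp
    ((measurable_inv_gram_apply i j).comp (measurable_columns hH))

lemma measurable_sqrt_smul (hlam : ∀ k, Measurable (lam k)) :
    Measurable fun p : Ω × (Fin K → EuclideanSpace ℂ (Fin M)) =>
      (fun k => ((√(lam k p.1 / 2) : ℝ) : ℂ)) • p.2 :=
  measurable_pi_lambda _ fun k => by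
    have := hlam k
    simp only [Pi.smul_apply']
    fun_prop

lemma IsRayleighFading.map_columns (h : IsRayleighFading μ lam H)
    (hlam : ∀ k, Measurable (lam k)) (hH : ∀ m k, Measurable fun ω => H ω m k) :
    μ.map (fun ω => columns (H ω)) =
      (μ.prod (Measure.pi fun _ => stdGaussian (EuclideanSpace ℂ (Fin M)))).map
        fun p => (fun k => ((√(lam k p.1 / 2) : ℝ) : ℂ)) • p.2 := by
  ext B hB
  have hsmul := measurable_sqrt_smul (M := M) hlam
  have htoLp : Measurable fun (z : Fin K → Fin M → ℂ) k => WithLp.toLp 2 (z k) :=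
    measurable_pi_lambda _ fun k => (WithLp.measurable_toLp 2 _).comp (measurable_pi_apply k)
  have hlaw := h Set.univ MeasurableSet.univ _ (htoLp hB)
  simp only [Set.mem_univ, true_and, Set.ofPred_true, Measure.restrict_univ] at hlaw
  rw [Measure.map_apply (measurable_columns hH) hB, Measure.map_apply hsmul hB,
    Measure.prod_apply (hsmul hB)]
  refine hlaw.trans (lintegral_congr fun ω => ?_)
  exact ((measurePreserving_smul_rayleighLaw M _).measure_preimage
    (htoLp hB).nullMeasurableSet).symm

lemma IsRayleighFading.ae_isUnit (h : IsRayleighFading μ lam H)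
    (hlam : ∀ k, Measurable (lam k)) (hH : ∀ m k, Measurable fun ω => H ω m k)
    (hpos : ∀ᵐ ω ∂μ, ∀ k, 0 < lam k ω) (hKM : K ≤ M) :
    ∀ᵐ ω ∂μ, IsUnit ((H ω)ᴴ * H ω) := by
  have hsmul := measurable_sqrt_smul (M := M) hlam
  have hset : MeasurableSet {z : Fin K → EuclideanSpace ℂ (Fin M) | LinearIndependent ℂ z} :=
    isOpen_setOfPred_linearIndependent.measurableSet
  simp_rw [isUnit_conjTranspose_mul_self_iff]
  refine ae_of_ae_map (p := fun z => LinearIndependent ℂ z) (measurable_columns hH).aemeasurable ?_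
  rw [h.map_columns hlam hH, ae_map_iff hsmul.aemeasurable hset]
  refine (Measure.ae_prod_iff_ae_ae (hsmul hset)).2 ?_
  filter_upwards [hpos] with ω hω
  filter_upwards [ae_pi_stdGaussian_linearIndependent (𝕜 := ℂ) (by simpa using hKM)] with z hz
  exact hz.units_smul fun k => Units.mk0 ((√(lam k ω / 2) : ℝ) : ℂ)
    (by exact_mod_cast (Real.sqrt_pos.2 (half_pos (hω k))).ne')

lemma lintegral_inv_gram_sqrt_smul {v : Fin K → ℝ} (hv : ∀ k, 0 < v k) (hKM : K < M)
    (k : Fin K) :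
    ∫⁻ z, ENNReal.ofReal ((Matrix.gram ℂ ((fun k => ((√(v k / 2) : ℝ) : ℂ)) • z))⁻¹ k k).re
        ∂Measure.pi (fun _ => stdGaussian (EuclideanSpace ℂ (Fin M))) =
      ENNReal.ofReal ((M - K : ℝ)⁻¹) * ENNReal.ofReal (v k)⁻¹ := by
  have hMK : (0 : ℝ) < M - K := sub_pos.2 (by exact_mod_cast hKM)
  have hvk := hv k
  have hsqrt : ∀ k, ((√(v k / 2) : ℝ) : ℂ) ≠ 0 := fun k => by
    exact_mod_cast (Real.sqrt_pos.2 (half_pos (hv k))).ne'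
  have hnorm : (‖((√(v k / 2) : ℝ) : ℂ)‖ ^ 2)⁻¹ = (v k / 2)⁻¹ := by
    rw [Complex.norm_real, Real.norm_eq_abs, sq_abs, Real.sq_sqrt (half_pos hvk).le]
  have hmeas : Measurable fun z : Fin K → EuclideanSpace ℂ (Fin M) =>
      ENNReal.ofReal ((Matrix.gram ℂ z)⁻¹ k k).re :=
    (Complex.measurable_re.comp (measurable_inv_gram_apply k k)).ennreal_ofReal
  have hmean := lintegral_inv_gram_apply_self_pi_stdGaussian (𝕜 := ℂ)
    (E := EuclideanSpace ℂ (Fin M)) (ι := Fin K) (by simp; omega) k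
  simp only [Complex.finrank_real_complex, finrank_euclideanSpace_fin, Fintype.card_fin,
    RCLike.re_eq_complex_re] at hmean
  calc _ = ∫⁻ z, ENNReal.ofReal (v k / 2)⁻¹ * ENNReal.ofReal ((Matrix.gram ℂ z)⁻¹ k k).re
        ∂Measure.pi (fun _ => stdGaussian (EuclideanSpace ℂ (Fin M))) := by
        refine lintegral_congr fun z => ?_
        rw [← ENNReal.ofReal_mul (by positivity), ← Complex.re_ofReal_mul, ← hnorm]
        exact congrArg _ (congrArg _ (inv_gram_smul_apply_self hsqrt z k))
    _ = _ := by
        rw [lintegral_const_mul _ hmeas, hmean, ← ENNReal.ofReal_mul (by positivity),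
          ← ENNReal.ofReal_mul (by positivity), ← mul_inv, ← mul_inv]
        congr 2
        push_cast
        ring

lemma IsRayleighFading.lintegral_inv_gram (h : IsRayleighFading μ lam H)
    (hlam : ∀ k, Measurable (lam k)) (hH : ∀ m k, Measurable fun ω => H ω m k)
    (hpos : ∀ᵐ ω ∂μ, ∀ k, 0 < lam k ω) (hKM : K < M) (k : Fin K) :
    ∫⁻ ω, ENNReal.ofReal (((H ω)ᴴ * H ω)⁻¹ k k).re ∂μ =
      ENNReal.ofReal ((M - K : ℝ)⁻¹) * ∫⁻ ω, ENNReal.ofReal (lam k ω)⁻¹ ∂μ := by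
  have hsmul := measurable_sqrt_smul (M := M) hlam
  have hmeas : Measurable fun z : Fin K → EuclideanSpace ℂ (Fin M) =>
      ENNReal.ofReal ((Matrix.gram ℂ z)⁻¹ k k).re :=
    (Complex.measurable_re.comp (measurable_inv_gram_apply k k)).ennreal_ofReal
  have hlamk := hlam k
  simp_rw [← gram_columns]
  rw [← lintegral_map hmeas (measurable_columns hH), h.map_columns hlam hH,
    lintegral_map hmeas hsmul, ← lintegral_const_mul _ (by fun_prop)]
  refine (lintegral_prod _ (hmeas.comp hsmul).aemeasurable).trans (lintegral_congr_ae ?_)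
  filter_upwards [hpos] with ω hω using lintegral_inv_gram_sqrt_smul hω hKM k

lemma IsRayleighFading.lintegral_power (h : IsRayleighFading μ lam H)
    (hlam : ∀ k, Measurable (lam k)) (hH : ∀ m k, Measurable fun ω => H ω m k)
    (hpos : ∀ᵐ ω ∂μ, ∀ k, 0 < lam k ω) (hKM : K < M) {ρ σ : ℝ} (hρ : 0 ≤ ρ) {k : Fin K}
    (hV : ∀ᵐ ω ∂μ, power (V ω) k = ρ * (M - K) * σ ^ 2 * (((H ω)ᴴ * H ω)⁻¹ k k).re) :
    ∫⁻ ω, ENNReal.ofReal (power (V ω) k) ∂μ =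
      ENNReal.ofReal ρ * ∫⁻ ω, ENNReal.ofReal (σ ^ 2 / lam k ω) ∂μ := by
  have hMK : (0 : ℝ) < M - K := sub_pos.2 (by exact_mod_cast hKM)
  have hlamk := hlam k
  have hpower : ∀ᵐ ω ∂μ, ENNReal.ofReal (power (V ω) k) =
      ENNReal.ofReal (ρ * (M - K) * σ ^ 2) * ENNReal.ofReal (((H ω)ᴴ * H ω)⁻¹ k k).re := by
    filter_upwards [hV] with ω hω
    rw [hω, ENNReal.ofReal_mul (by positivity)]
  simp_rw [lintegral_congr_ae hpower, div_eq_mul_inv, ENNReal.ofReal_mul (sq_nonneg σ)]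
  rw [lintegral_const_mul _ (measurable_re_inv_conjTranspose_mul_self_apply hH k k).ennreal_ofReal,
    lintegral_const_mul _ (by fun_prop), h.lintegral_inv_gram hlam hH hpos hKM, ← mul_assoc,
    ← mul_assoc, ← ENNReal.ofReal_mul (by positivity), ← ENNReal.ofReal_mul hρ]
  field_simp

lemma IsRayleighFading.integrable_and_integral_power (h : IsRayleighFading μ lam H)
    (hlam : ∀ k, Measurable (lam k)) (hH : ∀ m k, Measurable fun ω => H ω m k)
    (hpos : ∀ᵐ ω ∂μ, ∀ k, 0 < lam k ω) (hKM : K < M) {ρ σ : ℝ} (hρ : 0 ≤ ρ) {k : Fin K}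
    (hV : ∀ᵐ ω ∂μ, power (V ω) k = ρ * (M - K) * σ ^ 2 * (((H ω)ᴴ * H ω)⁻¹ k k).re)
    (hint : Integrable (fun ω => σ ^ 2 / lam k ω) μ) :
    Integrable (fun ω => power (V ω) k) μ ∧
      ∫ ω, power (V ω) k ∂μ = ρ * ∫ ω, σ ^ 2 / lam k ω ∂μ := by
  have hnonneg : 0 ≤ᵐ[μ] fun ω => σ ^ 2 / lam k ω := by
    filter_upwards [hpos] with ω hω using div_nonneg (sq_nonneg σ) (hω k).le
  have hmeas : AEStronglyMeasurable (fun ω => power (V ω) k) μ :=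
    ((measurable_re_inv_conjTranspose_mul_self_apply hH k k).const_mul _).aestronglyMeasurable.congr
      (ae_eq_symm hV)
  refine integrable_and_integral_eq_of_lintegral_ofReal_eq hmeas
    (ae_of_all _ fun ω => sq_nonneg _) (mul_nonneg hρ (integral_nonneg_of_ae hnonneg)) ?_
  rw [h.lintegral_power hlam hH hpos hKM hρ hV, ENNReal.ofReal_mul hρ,
    ofReal_integral_eq_lintegral_ofReal hint hnonneg]

lemma avgRate_eq_of_ae_rate_eq [IsProbabilityMeasure μ] {T : ℕ} {σ R : ℝ} {k : Fin K}
    (h : ∀ᵐ ω ∂μ, rate T σ (H ω) (V ω) k = R) : avgRate μ T σ H V k = R := by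
  have hconst : ∫ ω, rate T σ (H ω) (V ω) k ∂μ = R := by
    rw [integral_congr_ae h, integral_const, probReal_univ, one_smul]
  rwa [avgRate, ← integral_const_mul]

end Fading

end ZFPrecoding

open ZFPrecoding in
theorem lemma1_general (M K T : ℕ) (hKT : K < T) (ρ σ : ℝ) (hρ : 0 ≤ ρ) (hσ : σ ≠ 0) :
    (∀ H : Matrix (Fin M) (Fin K) ℂ, IsUnit (Hᴴ * H) →
      (∀ V : Matrix (Fin M) (Fin K) ℂ, IsZF H V →
        (∀ k, rate T σ H V k =
          (1 - (K : ℝ) / T) * Real.logb 2 (1 + ρ * ((M : ℝ) - K))) →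
        ((∑ k, power V k : ℝ) : ℂ) =
          ((ρ * σ ^ 2 * ((M : ℝ) - K) : ℝ) : ℂ) * ((Hᴴ * H)⁻¹).trace) ∧
      IsZF H (zf ρ σ H) ∧
      (∀ k, (Hᴴ * zf ρ σ H) k k =
        ((Real.sqrt (ρ * σ ^ 2 * ((M : ℝ) - K)) : ℝ) : ℂ)) ∧
      (∀ k, rate T σ H (zf ρ σ H) k =
        (1 - (K : ℝ) / T) * Real.logb 2 (1 + ρ * ((M : ℝ) - K)))) ∧
    (K < M →
      ∀ (Ω : Type*) [MeasurableSpace Ω] (μ : Measure Ω) [IsProbabilityMeasure μ]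
        (f : ℝ → ℝ) (lam : Fin K → Ω → ℝ) (H V : Ω → Matrix (Fin M) (Fin K) ℂ),
        Measurable f → (∀ x, 0 ≤ f x) →
        (∀ k, Measurable (lam k)) → (∀ m k, Measurable fun ω => H ω m k) →
        (∀ k, HasPosDensity μ (lam k) f) →
        IsRayleighFading μ lam H →
        (∀ᵐ ω ∂μ, IsUnit ((H ω)ᴴ * H ω) → IsZF (H ω) (V ω) ∧
          ∀ k, rate T σ (H ω) (V ω) k =
            (1 - (K : ℝ) / T) * Real.logb 2 (1 + ρ * ((M : ℝ) - K))) →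
        (∀ᵐ ω ∂μ, IsUnit ((H ω)ᴴ * H ω)) ∧
        (∀ k, avgRate μ T σ H V k =
          (1 - (K : ℝ) / T) * Real.logb 2 (1 + ρ * ((M : ℝ) - K))) ∧
        (∀ k, ∫⁻ ω, ENNReal.ofReal (σ ^ 2 / lam k ω) ∂μ = propConstENN σ f) ∧
        ∑ k, ∫⁻ ω, ENNReal.ofReal (power (V ω) k) ∂μ =
          ENNReal.ofReal (ρ * K) * propConstENN σ f ∧
        (IntegrableOn (fun x => σ ^ 2 / x * f x) (Set.Ioi 0) →
          (∀ k, Integrable (fun ω => σ ^ 2 / lam k ω) μ ∧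
            ∫ ω, σ ^ 2 / lam k ω ∂μ = propConst σ f) ∧
          (∀ k, Integrable (fun ω => power (V ω) k) μ) ∧
          ∑ k, ∫ ω, power (V ω) k ∂μ = ρ * K * propConst σ f)) := by
  have hnonneg (hKM : K ≤ M) : 0 ≤ ρ * ((M : ℝ) - K) :=
    mul_nonneg hρ (sub_nonneg.2 (by exact_mod_cast hKM))
  refine ⟨fun H hH => ⟨fun V hV hrate => ?_, isZF_zf ρ σ H, conjTranspose_mul_zf_apply_self hH ρ σ,
    fun k => by rw [rate, sinr_zf hH hρ hσ]⟩,
    fun hKM Ω _ μ _ f lam H V hf hf0 hlam hH hdens hfad hV => ?_⟩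
  · rw [hV.ofReal_sum_power_eq_of_rate_eq hH hKT hσ
      (hnonneg (le_of_isUnit_conjTranspose_mul_self hH)) hrate, mul_right_comm]
  have hpos : ∀ᵐ ω ∂μ, ∀ k, 0 < lam k ω := ae_all_iff.2 fun k => (hdens k).ae_pos (hlam k)
  have hunit := hfad.ae_isUnit hlam hH hpos hKM.le
  have hpower (k) : ∀ᵐ ω ∂μ,
      power (V ω) k = ρ * (M - K) * σ ^ 2 * (((H ω)ᴴ * H ω)⁻¹ k k).re := by
    filter_upwards [hunit, hV] with ω hω hVω using
      (hVω hω).1.power_eq_of_rate_eq hω hKT hσ (hnonneg hKM.le) ((hVω hω).2 k)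
  have hA (k) := (hdens k).lintegral_div (hlam k) hf hf0 σ
  refine ⟨hunit, fun k => avgRate_eq_of_ae_rate_eq ?_, hA, ?_, fun hint => ?_⟩
  · filter_upwards [hunit, hV] with ω hω hVω using (hVω hω).2 k
  · have hP (k) := hfad.lintegral_power hlam hH hpos hKM hρ (hpower k)
    simp [hP, hA, ENNReal.ofReal_mul hρ, mul_left_comm, mul_assoc]
  · have hAreal (k) := (hdens k).integrable_and_integral_div (hlam k) hf hf0 hint
    have hP (k) :=
      hfad.integrable_and_integral_power hlam hH hpos hKM hρ (hpower k) (hAreal k).1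
    exact ⟨hAreal, fun k => (hP k).1, by simp [hP, hAreal, mul_left_comm, mul_assoc]⟩

theorem lemma1 (M K T : ℕ) (hKT : K < T) (ρ σ : ℝ) (hρ : 0 < ρ) (hσ : 0 < σ) :
    -- a fixed channel realization
    (∀ H : Matrix (Fin M) (Fin K) ℂ, IsUnit (Hᴴ * H) →
      (∀ V : Matrix (Fin M) (Fin K) ℂ, ZFPrecoding.IsZF H V →
        (∀ k, ZFPrecoding.rate T σ H V k =
          (1 - (K : ℝ) / T) * Real.logb 2 (1 + ρ * ((M : ℝ) - K))) →
        ((∑ k, ZFPrecoding.power V k : ℝ) : ℂ) =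
          ((ρ * σ ^ 2 * ((M : ℝ) - K) : ℝ) : ℂ) * ((Hᴴ * H)⁻¹).trace) ∧
      ZFPrecoding.IsZF H (ZFPrecoding.zf ρ σ H) ∧
      (∀ k, (Hᴴ * ZFPrecoding.zf ρ σ H) k k =
        ((Real.sqrt (ρ * σ ^ 2 * ((M : ℝ) - K)) : ℝ) : ℂ)) ∧
      (∀ k, ZFPrecoding.rate T σ H (ZFPrecoding.zf ρ σ H) k =
        (1 - (K : ℝ) / T) * Real.logb 2 (1 + ρ * ((M : ℝ) - K)))) ∧
    -- the average over Rayleigh fading with random variances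
    (K < M →
      ∀ (Ω : Type*) [MeasurableSpace Ω] (μ : MeasureTheory.Measure Ω)
        [MeasureTheory.IsProbabilityMeasure μ]
        (f : ℝ → ℝ) (lam : Fin K → Ω → ℝ) (H V : Ω → Matrix (Fin M) (Fin K) ℂ),
        Measurable f → (∀ x, 0 ≤ f x) →
        (∀ k, Measurable (lam k)) → (∀ m k, Measurable fun ω => H ω m k) →
        ProbabilityTheory.iIndepFun lam μ →
        (∀ k, ZFPrecoding.HasPosDensity μ (lam k) f) →
        ZFPrecoding.IsRayleighFading μ lam H →
        (∀ᵐ ω ∂μ, IsUnit ((H ω)ᴴ * H ω) → ZFPrecoding.IsZF (H ω) (V ω) ∧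
          ∀ k, ZFPrecoding.rate T σ (H ω) (V ω) k =
            (1 - (K : ℝ) / T) * Real.logb 2 (1 + ρ * ((M : ℝ) - K))) →
        (∀ᵐ ω ∂μ, IsUnit ((H ω)ᴴ * H ω)) ∧
        (∀ k, ZFPrecoding.avgRate μ T σ H V k =
          (1 - (K : ℝ) / T) * Real.logb 2 (1 + ρ * ((M : ℝ) - K))) ∧
        -- the average power as an identity in `[0, ∞]`
        (∀ k, ∫⁻ ω, ENNReal.ofReal (σ ^ 2 / lam k ω) ∂μ = ZFPrecoding.propConstENN σ f) ∧
        ∑ k, ∫⁻ ω, ENNReal.ofReal (ZFPrecoding.power (V ω) k) ∂μ =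
          ENNReal.ofReal (ρ * K) * ZFPrecoding.propConstENN σ f ∧
        -- the average power as an identity of real numbers
        (MeasureTheory.IntegrableOn (fun x => σ ^ 2 / x * f x) (Set.Ioi 0) →
          (∀ k, MeasureTheory.Integrable (fun ω => σ ^ 2 / lam k ω) μ ∧
            ∫ ω, σ ^ 2 / lam k ω ∂μ = ZFPrecoding.propConst σ f) ∧
          (∀ k, MeasureTheory.Integrable (fun ω => ZFPrecoding.power (V ω) k) μ) ∧
          ∑ k, ∫ ω, ZFPrecoding.power (V ω) k ∂μ = ρ * K * ZFPrecoding.propConst σ f)) :=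
  have h := lemma1_general M K T hKT ρ σ hρ.le hσ.ne'
  ⟨h.1, fun hKM Ω _ μ _ f lam H V hf hf0 hlam hH _ => h.2 hKM Ω μ f lam H V hf hf0 hlam hH⟩
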